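/- There exist a finite simple planar triconnected graph $G$ and a path $P$ on the same vertex set (so $P$ is a graph isomorphic to a path that contains all vertices of $G$) such that $G$ and $P$ do not admit a simultaneous geometric embedding; that is, there are no planar (crossing-free) straight-line drawings of $G$ and of $P$ in $\mathbb{R}^2$ in which every vertex has the same position in both drawings. Here a graph is triconnected if it has at least four vertices and remains connected after the deletion of any set of at most two vertices. -/

import Mathlib

/-- The Euclidean plane. -/
abbrev Plane : Type := EuclideanSpace ℝ (Fin 2)

/-- `S` is a simple arc in the plane with end points `a` and `b`: the image of an injective
continuous curve from `a` to `b`. -/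
def IsArcBetween (S : Set Plane) (a b : Plane) : Prop :=
  ∃ γ : Path a b, Function.Injective γ ∧ Set.range γ = S

/-- A planar (crossing-free) drawing of a graph: distinct vertices are distinct points, every edge
is a simple arc joining its two end points, an edge contains no vertex other than its end points,
and two distinct edges meet at most in the points of common end vertices. -/
structure PlanarDrawing {V : Type*} (G : SimpleGraph V) where
  /-- the point that represents a vertex -/
  pos : V → Plane
  /-- the arc that represents an edge (irrelevant on pairs that are not edges) -/
  arc : Sym2 V → Set Plane
  pos_injective : Function.Injective pos
  arc_isArc : ∀ u v : V, G.Adj u v → IsArcBetween (arc s(u, v)) (pos u) (pos v)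
  pos_notMem_arc : ∀ e ∈ G.edgeSet, ∀ w : V, w ∉ e → pos w ∉ arc e
  arc_inter_arc : ∀ e ∈ G.edgeSet, ∀ f ∈ G.edgeSet, e ≠ f →
    ∀ x ∈ arc e ∩ arc f, ∃ w : V, w ∈ e ∧ w ∈ f ∧ x = pos w

/-- The drawing is straight-line: each edge is the segment between its end points. -/
def PlanarDrawing.IsStraightLine {V : Type*} {G : SimpleGraph V} (D : PlanarDrawing G) : Prop :=
  ∀ u v : V, G.Adj u v → D.arc s(u, v) = segment ℝ (D.pos u) (D.pos v)

/-- A graph is planar if it has a planar drawing (edges being arbitrary simple arcs). -/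
def IsPlanarGraph {V : Type*} (G : SimpleGraph V) : Prop :=
  Nonempty (PlanarDrawing G)

/-- Two graphs on the same vertex set have a simultaneous geometric embedding: there are planar
straight-line drawings of both in which each vertex has the same position. (The two drawings
together may have crossings between an edge of one graph and an edge of the other.) -/
def HasSGE {V : Type*} (G₁ G₂ : SimpleGraph V) : Prop :=
  ∃ (D₁ : PlanarDrawing G₁) (D₂ : PlanarDrawing G₂),
    D₁.IsStraightLine ∧ D₂.IsStraightLine ∧ ∀ v : V, D₁.pos v = D₂.pos v

/-- Triconnected: more than three vertices, and deleting any set of at most two vertices leaves a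
connected graph. -/
def IsTriconnected {V : Type*} [Fintype V] (G : SimpleGraph V) : Prop :=
  3 < Fintype.card V ∧
    ∀ S : Finset V, S.card ≤ 2 → (G.induce {v : V | v ∉ S}).Connected

/-- The graph `P` is a path through all `n` vertices. -/
def IsSpanningPath {n : ℕ} (P : SimpleGraph (Fin n)) : Prop :=
  Nonempty (P ≃g SimpleGraph.pathGraph n)

/-! The graph is a triangle 1 3 5 with two nonadjacent apices 4 and 2, a vertex 0 joined to 3, 4, 5
and a vertex 6 joined to 1, 2, 3; the path is 0 1 2 3 4 5 6. In every straight-line drawing one apex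
lies inside 1 3 5 (`inside_or_inside`). If it is 4, then 0 lies inside 3 4 5, so the path edge 0 1
meets 3 4 or 4 5 (`not_disjoint_of_inside`), which are path edges too. If it is 2, then 5 6 meets 1
2 or 2 3 likewise.

`inside_or_inside` rests on signs of barycentric coordinates: an apex outside the triangle lies in
the cone opposite to a corner, and two such apices force a crossing. Planarity and triconnectivity
are finite checks. -/

namespace PathGraphSGE

/-! ### Signed areas, barycentric coordinates and crossing segments -/

/-- Twice the signed area of the triangle `p q r`. -/
def orient (p q r : Plane) : ℝ :=
  (q 0 - p 0) * (r 1 - p 1) - (q 1 - p 1) * (r 0 - p 0)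

/-- `c` lies in the interior of the triangle `x y z`. -/
def Inside (x y z c : Plane) : Prop :=
  ∃ α β γ : ℝ, 0 < α ∧ 0 < β ∧ 0 < γ ∧ α + β + γ = 1 ∧ c = α • x + β • y + γ • z

theorem plane_ext {p q : Plane} (h0 : p 0 = q 0) (h1 : p 1 = q 1) : p = q := by
  ext i
  fin_cases i
  · exact h0
  · exact h1

theorem mem_segment_of_eq {p q r : Plane} {a b : ℝ} (ha : 0 ≤ a) (hb : 0 ≤ b) (hab : a + b = 1)
    (h : r = a • p + b • q) : r ∈ segment ℝ p q :=
  ⟨a, b, ha, hb, hab, h.symm⟩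

theorem orient_swap (p q r : Plane) : orient q p r = -orient p q r := by
  simp only [orient]; ring

theorem orient_rotate (p q r : Plane) : orient q r p = orient p q r := by
  simp only [orient]; ring

/-- Signed area is a 3 × 3 determinant in homogeneous coordinates, hence multiplicative. -/
theorem orient_barycentric {x y z p q r : Plane} {a₁ b₁ c₁ a₂ b₂ c₂ a₃ b₃ c₃ : ℝ}
    (hp : p = a₁ • x + b₁ • y + c₁ • z) (h₁ : a₁ + b₁ + c₁ = 1)
    (hq : q = a₂ • x + b₂ • y + c₂ • z) (h₂ : a₂ + b₂ + c₂ = 1)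
    (hr : r = a₃ • x + b₃ • y + c₃ • z) (h₃ : a₃ + b₃ + c₃ = 1) :
    orient p q r = (a₁ * (b₂ * c₃ - c₂ * b₃) - b₁ * (a₂ * c₃ - c₂ * a₃)
      + c₁ * (a₂ * b₃ - b₂ * a₃)) * orient x y z := by
  obtain rfl : a₁ = 1 - b₁ - c₁ := by linarith
  obtain rfl : a₂ = 1 - b₂ - c₂ := by linarith
  obtain rfl : a₃ = 1 - b₃ - c₃ := by linarith
  subst hp hq hr
  simp only [orient, PiLp.add_apply, PiLp.smul_apply, smul_eq_mul]
  ring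

theorem eq_comb_fst (x y z : Plane) : x = (1 : ℝ) • x + (0 : ℝ) • y + (0 : ℝ) • z := by simp

theorem eq_comb_snd (x y z : Plane) : y = (0 : ℝ) • x + (1 : ℝ) • y + (0 : ℝ) • z := by simp

theorem eq_comb_trd (x y z : Plane) : z = (0 : ℝ) • x + (0 : ℝ) • y + (1 : ℝ) • z := by simp

/-- Two segments meet if the end points of each lie on different sides of the other. -/
theorem not_disjoint_segment {p q r s : Plane} (h₁ : orient p q r * orient p q s < 0)
    (h₂ : orient r s p * orient r s q ≤ 0) :
    ¬ Disjoint (segment ℝ p q) (segment ℝ r s) := by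
  -- Both sides are the cross product of `q - p` and `r - s`: the common denominator of the weights
  -- of the intersection point on the two segments.
  have key : orient p q r - orient p q s = orient r s q - orient r s p := by
    simp only [orient]; ring
  have hne : orient p q r - orient p q s ≠ 0 := by
    intro h
    rw [sub_eq_zero.1 h] at h₁
    exact absurd h₁ (not_lt.2 (mul_self_nonneg _))
  have hA : 0 ≤ orient p q r / (orient p q r - orient p q s) ∧
      0 ≤ -orient p q s / (orient p q r - orient p q s) ∧
      0 ≤ orient r s q / (orient p q r - orient p q s) ∧
      0 ≤ -orient r s p / (orient p q r - orient p q s) := by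
    rcases mul_neg_iff.1 h₁ with ⟨ha, hb⟩ | ⟨ha, hb⟩
    · have hE : 0 ≤ orient r s q := by nlinarith
      have hC : orient r s p ≤ 0 := by nlinarith
      refine ⟨div_nonneg ?_ ?_, div_nonneg ?_ ?_, div_nonneg ?_ ?_, div_nonneg ?_ ?_⟩ <;> linarith
    · have hE : orient r s q ≤ 0 := by nlinarith
      have hC : 0 ≤ orient r s p := by nlinarith
      refine ⟨div_nonneg_of_nonpos ?_ ?_, div_nonneg_of_nonpos ?_ ?_, div_nonneg_of_nonpos ?_ ?_,
        div_nonneg_of_nonpos ?_ ?_⟩ <;> linarith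
  obtain ⟨h1, h2, h3, h4⟩ := hA
  refine Set.not_disjoint_iff.2 ⟨_, mem_segment_of_eq h3 h4 ?_ rfl,
    mem_segment_of_eq h2 h1 ?_ (plane_ext ?_ ?_)⟩
  · rw [← add_div, key, ← sub_eq_add_neg, div_self (key ▸ hne)]
  · rw [← add_div, neg_add_eq_sub, div_self hne]
  all_goals
    simp only [PiLp.add_apply, PiLp.smul_apply, smul_eq_mul]
    field_simp
    simp only [orient]
    ring

/-- Of three collinear points one lies between the two others. -/
theorem mem_segment_of_orient_eq_zero {p q r : Plane} (h : orient p q r = 0) :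
    p ∈ segment ℝ q r ∨ q ∈ segment ℝ p r ∨ r ∈ segment ℝ p q := by
  have hc : Collinear ℝ ({p, q, r} : Set Plane) := by
    rw [collinear_iff_of_mem (p₀ := p) (by simp)]
    by_cases hpq : q = p
    · refine ⟨r - p, ?_⟩
      rintro s (rfl | rfl | rfl)
      · exact ⟨0, by simp⟩
      · exact ⟨0, by simp [hpq]⟩
      · exact ⟨1, by simp⟩
    · refine ⟨q - p, ?_⟩
      rintro s (rfl | rfl | rfl)
      · exact ⟨0, by simp⟩
      · exact ⟨1, by simp⟩
      · by_cases h0 : q 0 - p 0 = 0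
        · have h1 : q 1 - p 1 ≠ 0 := fun h1 =>
            hpq (plane_ext (sub_eq_zero.1 h0) (sub_eq_zero.1 h1))
          refine ⟨(s 1 - p 1) / (q 1 - p 1), plane_ext ?_ ?_⟩ <;>
            simp only [vadd_eq_add, PiLp.add_apply, PiLp.smul_apply, PiLp.sub_apply, smul_eq_mul]
          all_goals
            field_simp
            simp only [orient] at h
            first | linear_combination h | linear_combination -h | linear_combination (0 : ℝ) * h
        · refine ⟨(s 0 - p 0) / (q 0 - p 0), plane_ext ?_ ?_⟩ <;>
            simp only [vadd_eq_add, PiLp.add_apply, PiLp.smul_apply, PiLp.sub_apply, smul_eq_mul]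
          all_goals
            field_simp
            simp only [orient] at h
            first | linear_combination h | linear_combination -h | linear_combination (0 : ℝ) * h
  rcases hc.wbtw_or_wbtw_or_wbtw with h | h | h
  · exact Or.inr (Or.inl h.mem_segment)
  · exact Or.inr (Or.inr (segment_symm ℝ q p ▸ h.mem_segment))
  · exact Or.inl (segment_symm ℝ r q ▸ h.mem_segment)

theorem exists_barycentric {x y z : Plane} (hT : orient x y z ≠ 0) (c : Plane) :
    ∃ α β γ : ℝ, α + β + γ = 1 ∧ c = α • x + β • y + γ • z := by
  refine ⟨orient c y z / orient x y z, orient x c z / orient x y z, orient x y c / orient x y z,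
    ?_, plane_ext ?_ ?_⟩
  · field_simp
    simp only [orient]
    ring
  all_goals
    simp only [PiLp.add_apply, PiLp.smul_apply, smul_eq_mul]
    field_simp
    simp only [orient]
    ring

/-- `c` lies in the cone opposite to the triangle `x y z` at its corner `x`. -/
def Behind (x y z c : Plane) : Prop :=
  ∃ α β γ : ℝ, β < 0 ∧ γ < 0 ∧ α + β + γ = 1 ∧ c = α • x + β • y + γ • z

/-- Rewrite the combination as `c - γ z = α x + β y` and divide by `α + β = 1 - γ`. -/
theorem not_disjoint_of_opposite {x y z c : Plane} {α β γ : ℝ} (hα : 0 < α) (hβ : 0 < β)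
    (hγ : γ < 0) (hs : α + β + γ = 1) (hc : c = α • x + β • y + γ • z) :
    ¬ Disjoint (segment ℝ x y) (segment ℝ z c) := by
  have h0 : 0 < α + β := by linarith
  refine Set.not_disjoint_iff.2 ⟨_, mem_segment_of_eq (a := α / (α + β)) (b := β / (α + β))
    (by positivity) (by positivity) (by field_simp) rfl,
    mem_segment_of_eq (a := -γ / (α + β)) (b := 1 / (α + β))
    (div_nonneg (by linarith) h0.le) (by positivity)
    (by rw [← add_div, div_eq_one_iff_eq h0.ne']; linarith) (plane_ext ?_ ?_)⟩
  all_goals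
    subst hc
    simp only [PiLp.add_apply, PiLp.smul_apply, smul_eq_mul]
    field_simp
    ring

theorem mul_mul_mul_neg {a b t : ℝ} (ht : t ≠ 0) (h : a * b < 0) : a * t * (b * t) < 0 := by
  rw [mul_mul_mul_comm]
  exact mul_neg_of_neg_of_pos h (mul_self_pos.2 ht)

theorem not_disjoint_of_comb {x y z c d : Plane} {α β γ α' β' γ' : ℝ}
    (hT : orient x y z ≠ 0) (hs : α + β + γ = 1) (hc : c = α • x + β • y + γ • z)
    (hs' : α' + β' + γ' = 1) (hd : d = α' • x + β' • y + γ' • z)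
    (hγ : γ < 0) (hγ' : γ' < 0) (h₁ : α * γ' - γ * α' < 0) (h₂ : 0 < β * γ' - γ * β') :
    ¬ Disjoint (segment ℝ c y) (segment ℝ d x) := by
  apply not_disjoint_segment
  · rw [orient_barycentric hc hs (eq_comb_snd x y z) (by norm_num) hd hs',
      orient_barycentric hc hs (eq_comb_snd x y z) (by norm_num) (eq_comb_fst x y z) (by norm_num)]
    refine mul_mul_mul_neg hT ?_
    nlinarith
  · rw [orient_barycentric hd hs' (eq_comb_fst x y z) (by norm_num) hc hs,
      orient_barycentric hd hs' (eq_comb_fst x y z) (by norm_num) (eq_comb_snd x y z) (by norm_num)]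
    refine (mul_mul_mul_neg hT ?_).le
    nlinarith

theorem not_disjoint_of_behind_of_behind {x y z c d : Plane} (hT : orient x y z ≠ 0)
    (hc : Behind x y z c) (hd : Behind y z x d) :
    ¬ Disjoint (segment ℝ c y) (segment ℝ d x) := by
  obtain ⟨α, β, γ, hβ, hγ, hs, hc⟩ := hc
  obtain ⟨β', γ', α', hγ', hα', hs', hd⟩ := hd
  refine not_disjoint_of_comb hT hs hc (by linarith : α' + β' + γ' = 1) (by rw [hd]; abel) hγ hγ'
    ?_ ?_
  · linarith [mul_neg_of_pos_of_neg (by linarith : 0 < α) hγ', mul_pos_of_neg_of_neg hγ hα']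
  · linarith [mul_pos_of_neg_of_neg hβ hγ', mul_neg_of_neg_of_pos hγ (by linarith : 0 < β')]

theorem not_disjoint_or_of_comb {x y z c d : Plane} {α β γ α' β' γ' : ℝ}
    (hT : orient x y z ≠ 0) (hs : α + β + γ = 1) (hc : c = α • x + β • y + γ • z)
    (hs' : α' + β' + γ' = 1) (hd : d = α' • x + β' • y + γ' • z)
    (hβ : β < 0) (hγ : γ < 0) (hβ' : β' < 0) (hγ' : γ' < 0) (h : 0 < β * γ' - γ * β') :
    ¬ Disjoint (segment ℝ c y) (segment ℝ d x) ∨ ¬ Disjoint (segment ℝ d z) (segment ℝ c x) := by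
  have hα : 0 < α := by linarith
  have hα' : 0 < α' := by linarith
  rcases lt_or_ge (α * γ' - γ * α') 0 with h₁ | h₁
  · exact Or.inl (not_disjoint_of_comb hT hs hc hs' hd hγ hγ' h₁ h)
  · have hT' : orient x z y ≠ 0 := by rwa [← orient_rotate, orient_swap, orient_rotate, neg_ne_zero]
    refine Or.inr (not_disjoint_of_comb hT' (by linarith : α' + γ' + β' = 1) (by rw [hd]; abel)
      (by linarith : α + γ + β = 1) (by rw [hc]; abel) hβ' hβ ?_ (by linarith))
    -- Uses `α (β γ' - γ β') = β (α γ' - γ α') + γ (α' β - β' α)`.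
    by_contra! h₂
    linarith [mul_nonpos_of_nonneg_of_nonpos h₁ hβ.le, mul_nonpos_of_nonneg_of_nonpos h₂ hγ.le,
      mul_pos hα h]

/-- Two points behind the same corner of a triangle cannot both be joined to the three corners. -/
theorem not_disjoint_or_mem_segment {x y z c d : Plane} (hT : orient x y z ≠ 0)
    (hc : Behind x y z c) (hd : Behind x y z d) :
    (¬ Disjoint (segment ℝ c y) (segment ℝ d x) ∨ ¬ Disjoint (segment ℝ d z) (segment ℝ c x)) ∨
      (¬ Disjoint (segment ℝ d y) (segment ℝ c x) ∨ ¬ Disjoint (segment ℝ c z) (segment ℝ d x)) ∨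
      d ∈ segment ℝ x c ∨ c ∈ segment ℝ x d := by
  obtain ⟨α, β, γ, hβ, hγ, hs, hc⟩ := hc
  obtain ⟨α', β', γ', hβ', hγ', hs', hd⟩ := hd
  rcases lt_trichotomy (β * γ' - γ * β') 0 with h | h | h
  · exact Or.inr (Or.inl
      (not_disjoint_or_of_comb hT hs' hd hs hc hβ' hγ' hβ hγ (by linarith)))
  · right; right
    -- The two points lie on one ray from `x`; the nearer is on the segment to the farther.
    have key : ∀ {β γ β' γ' : ℝ}, β < 0 → β' < 0 → β * γ' = γ * β' → β ≤ β' →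
        (1 - β' - γ') • x + β' • y + γ' • z ∈ segment ℝ x ((1 - β - γ) • x + β • y + γ • z) := by
      intro β γ β' γ' hβ hβ' h hle
      have hβ0 := hβ.ne
      refine mem_segment_of_eq (a := 1 - β' / β) (b := β' / β) ?_
        (div_nonneg_of_nonpos hβ'.le hβ.le) (by ring) (plane_ext ?_ ?_)
      · rw [sub_nonneg, div_le_one_of_neg hβ]; exact hle
      all_goals
        obtain rfl : γ' = γ * β' / β := by field_simp; linarith
        simp only [PiLp.add_apply, PiLp.smul_apply, smul_eq_mul]
        field_simp
        ring
    obtain rfl : α = 1 - β - γ := by linarith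
    obtain rfl : α' = 1 - β' - γ' := by linarith
    subst hc hd
    rcases le_total β β' with hle | hle
    · exact Or.inl (key hβ hβ' (by linarith) hle)
    · exact Or.inr (key hβ' hβ (by linarith) hle)
  · exact Or.inl (not_disjoint_or_of_comb hT hs hc hs' hd hβ hγ hβ' hγ' h)

/-- Comparing areas over the base `x y` would give `γ γ' = 1` with both factors below 1. -/
theorem not_inside_of_inside {x y z c : Plane} (hT : orient x y z ≠ 0) (h : Inside x y z c) :
    ¬ Inside x y c z := by
  rintro ⟨α', β', γ', hα', hβ', hγ', hs', hz⟩
  obtain ⟨α, β, γ, hα, hβ, hγ, hs, hc⟩ := h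
  have h₁ := orient_barycentric (eq_comb_fst x y z) (by norm_num) (eq_comb_snd x y z) (by norm_num)
    hc hs
  have h₂ := orient_barycentric (eq_comb_fst x y c) (by norm_num) (eq_comb_snd x y c) (by norm_num)
    hz hs'
  have h₃ : (γ' * γ - 1) * orient x y z = 0 := by
    rw [h₁] at h₂
    linarith
  have h₄ := (mul_eq_zero.1 h₃).resolve_right hT
  nlinarith

/-- A point `d` of the triangle `x y c`, where `c` is inside `x y z`, is hidden from `z` by the
two sides at `c`. -/
theorem not_disjoint_of_inside_of_inside {x y z c d : Plane} (hT : orient x y z ≠ 0)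
    (hc : Inside x y z c) (hd : Inside x y c d) :
    ¬ Disjoint (segment ℝ x c) (segment ℝ z d) ∨ ¬ Disjoint (segment ℝ y c) (segment ℝ z d) := by
  obtain ⟨α, β, γ, hα, hβ, hγ, hs, hc⟩ := hc
  obtain ⟨α', β', γ', hα', hβ', hγ', hs', hd⟩ := hd
  have hd₁ : d = (α' + γ' * α) • x + (β' + γ' * β) • y + (γ' * γ) • z := by
    rw [hd, hc]; module
  have hs₁ : (α' + γ' * α) + (β' + γ' * β) + γ' * γ = 1 := by
    linear_combination hs' + γ' * hs
  have hB : 0 < β' + γ' * β := by positivity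
  have hA : 0 < α' + γ' * α := by positivity
  have hz := eq_comb_trd x y z
  -- The side of the line `z c` on which `d` lies selects the segment hit. Equality puts `d` on that
  -- line, which is why `not_disjoint_segment` allows zero in `h₂`.
  rcases le_total (α * β') (β * α') with h | h
  · have hx := eq_comb_fst x y z
    refine Or.inl (not_disjoint_segment ?_ ?_)
    · rw [orient_barycentric hx (by norm_num) hc hs hz (by norm_num),
        orient_barycentric hx (by norm_num) hc hs hd₁ hs₁]
      refine mul_mul_mul_neg hT ?_
      linarith [mul_pos hβ (mul_pos hβ' hγ)]
    · rw [orient_barycentric hz (by norm_num) hd₁ hs₁ hx (by norm_num),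
        orient_barycentric hz (by norm_num) hd₁ hs₁ hc hs, mul_mul_mul_comm]
      refine mul_nonpos_of_nonpos_of_nonneg ?_ (mul_self_nonneg _)
      linarith [mul_nonneg hB.le (sub_nonneg.2 h)]
  · have hy := eq_comb_snd x y z
    refine Or.inr (not_disjoint_segment ?_ ?_)
    · rw [orient_barycentric hy (by norm_num) hc hs hz (by norm_num),
        orient_barycentric hy (by norm_num) hc hs hd₁ hs₁]
      refine mul_mul_mul_neg hT ?_
      linarith [mul_pos hα (mul_pos hα' hγ)]
    · rw [orient_barycentric hz (by norm_num) hd₁ hs₁ hy (by norm_num),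
        orient_barycentric hz (by norm_num) hd₁ hs₁ hc hs, mul_mul_mul_comm]
      refine mul_nonpos_of_nonpos_of_nonneg ?_ (mul_self_nonneg _)
      linarith [mul_nonneg hA.le (sub_nonneg.2 h)]

/-! ### Straight-line drawings of `K₄` and of `K₅` minus an edge -/

section Drawing

variable {V : Type*} {G : SimpleGraph V} {D : PlanarDrawing G}

theorem pos_notMem_segment (hD : D.IsStraightLine) {u v w : V} (h : G.Adj u v) (hu : w ≠ u)
    (hv : w ≠ v) : D.pos w ∉ segment ℝ (D.pos u) (D.pos v) := by
  rw [← hD u v h]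
  exact D.pos_notMem_arc s(u, v) h w (by simp [hu, hv])

theorem disjoint_segment (hD : D.IsStraightLine) {u v w t : V} (h : G.Adj u v) (h' : G.Adj w t)
    (huw : u ≠ w) (hut : u ≠ t) (hvw : v ≠ w) (hvt : v ≠ t) :
    Disjoint (segment ℝ (D.pos u) (D.pos v)) (segment ℝ (D.pos w) (D.pos t)) := by
  rw [← hD u v h, ← hD w t h', Set.disjoint_iff]
  rintro s hs
  obtain ⟨a, ha, hb, -⟩ := D.arc_inter_arc s(u, v) h s(w, t) h'
    (by simp [huw, hut]) s hs
  rw [Sym2.mem_iff] at ha hb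
  rcases ha with rfl | rfl <;> rcases hb with rfl | rfl <;> contradiction

theorem orient_ne_zero (hD : D.IsStraightLine) {u v w : V} (huv : G.Adj u v) (hvw : G.Adj v w)
    (huw : G.Adj u w) : orient (D.pos u) (D.pos v) (D.pos w) ≠ 0 := by
  intro h
  rcases mem_segment_of_orient_eq_zero h with h | h | h
  · exact pos_notMem_segment hD hvw huv.ne huw.ne h
  · exact pos_notMem_segment hD huw huv.ne' hvw.ne h
  · exact pos_notMem_segment hD huv huw.ne' hvw.ne' h

/-- In a straight-line drawing of `K₄`, a vertex that is not inside the triangle of the others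
lies behind one of its corners. -/
theorem inside_or_behind (hD : D.IsStraightLine) {x y z c : V} (hxy : G.Adj x y)
    (hyz : G.Adj y z) (hxz : G.Adj x z) (hx : G.Adj x c) (hy : G.Adj y c) (hz : G.Adj z c) :
    Inside (D.pos x) (D.pos y) (D.pos z) (D.pos c) ∨
      Behind (D.pos x) (D.pos y) (D.pos z) (D.pos c) ∨
      Behind (D.pos y) (D.pos z) (D.pos x) (D.pos c) ∨
      Behind (D.pos z) (D.pos x) (D.pos y) (D.pos c) := by
  have hT := orient_ne_zero hD hxy hyz hxz
  have d₁ := disjoint_segment hD hxy hz hxz.ne hx.ne hyz.ne hy.ne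
  have d₂ := disjoint_segment hD hyz hx hxy.ne' hy.ne hxz.ne' hz.ne
  have d₃ := disjoint_segment hD hxz.symm hy hyz.ne' hz.ne hxy.ne hx.ne
  obtain ⟨α, β, γ, hs, hc⟩ := exists_barycentric hT (D.pos c)
  -- A zero weight would make `c` collinear with two corners.
  have hα : α ≠ 0 := by
    rintro rfl
    apply orient_ne_zero hD hyz hz hy
    rw [orient_barycentric (eq_comb_snd _ _ _) (by norm_num) (eq_comb_trd _ _ _) (by norm_num) hc hs]
    ring
  have hβ : β ≠ 0 := by
    rintro rfl
    apply orient_ne_zero hD hxz hz hx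
    rw [orient_barycentric (eq_comb_fst _ (D.pos y) _) (by norm_num) (eq_comb_trd _ _ _)
      (by norm_num) hc hs]
    ring
  have hγ : γ ≠ 0 := by
    rintro rfl
    apply orient_ne_zero hD hxy hy hx
    rw [orient_barycentric (eq_comb_fst _ _ (D.pos z)) (by norm_num) (eq_comb_snd _ _ _)
      (by norm_num) hc hs]
    ring
  have hc₂ : D.pos c = β • D.pos y + γ • D.pos z + α • D.pos x := by rw [hc]; abel
  have hc₃ : D.pos c = γ • D.pos z + α • D.pos x + β • D.pos y := by rw [hc]; abel
  -- Exactly one negative weight makes the edge from `c` to that corner cross the opposite side.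
  rcases hα.lt_or_gt with hα | hα <;> rcases hβ.lt_or_gt with hβ | hβ <;>
    rcases hγ.lt_or_gt with hγ | hγ
  · linarith
  · exact Or.inr (Or.inr (Or.inr ⟨γ, α, β, hα, hβ, by linarith, hc₃⟩))
  · exact Or.inr (Or.inr (Or.inl ⟨β, γ, α, hγ, hα, by linarith, hc₂⟩))
  · exact absurd d₂ (not_disjoint_of_opposite hβ hγ hα (by linarith) hc₂)
  · exact Or.inr (Or.inl ⟨α, β, γ, hβ, hγ, hs, hc⟩)
  · exact absurd d₃ (not_disjoint_of_opposite hγ hα hβ (by linarith) hc₃)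
  · exact absurd d₁ (not_disjoint_of_opposite hα hβ hγ hs hc)
  · exact Or.inl ⟨α, β, γ, hα, hβ, hγ, hs, hc⟩

/-- Two vertices behind the same corner of a triangle cannot both be adjacent to its corners. -/
theorem not_behind_behind_same (hD : D.IsStraightLine) {x y z c d : V} (hxy : G.Adj x y)
    (hyz : G.Adj y z) (hxz : G.Adj x z) (hxc : G.Adj x c) (hyc : G.Adj y c) (hzc : G.Adj z c)
    (hxd : G.Adj x d) (hyd : G.Adj y d) (hzd : G.Adj z d) (hcd : c ≠ d)
    (hc : Behind (D.pos x) (D.pos y) (D.pos z) (D.pos c)) :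
    ¬ Behind (D.pos x) (D.pos y) (D.pos z) (D.pos d) := by
  intro hd
  rcases not_disjoint_or_mem_segment (orient_ne_zero hD hxy hyz hxz) hc hd with
    (h | h) | (h | h) | h | h
  · exact h (disjoint_segment hD hyc.symm hxd.symm hcd hxc.ne' hyd.ne hxy.ne')
  · exact h (disjoint_segment hD hzd.symm hxc.symm hcd.symm hxd.ne' hzc.ne hxz.ne')
  · exact h (disjoint_segment hD hyd.symm hxc.symm hcd.symm hxd.ne' hyc.ne hxy.ne')
  · exact h (disjoint_segment hD hzc.symm hxd.symm hcd hxc.ne' hzd.ne hxz.ne')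
  · exact pos_notMem_segment hD hxc hxd.ne' hcd.symm h
  · exact pos_notMem_segment hD hxd hxc.ne' hcd h

theorem not_behind_behind_next (hD : D.IsStraightLine) {x y z c d : V} (hxy : G.Adj x y)
    (hyz : G.Adj y z) (hxz : G.Adj x z) (hxc : G.Adj x c) (hyc : G.Adj y c)
    (hxd : G.Adj x d) (hyd : G.Adj y d) (hcd : c ≠ d)
    (hc : Behind (D.pos x) (D.pos y) (D.pos z) (D.pos c)) :
    ¬ Behind (D.pos y) (D.pos z) (D.pos x) (D.pos d) := fun hd =>
  not_disjoint_of_behind_of_behind (orient_ne_zero hD hxy hyz hxz) hc hd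
    (disjoint_segment hD hyc.symm hxd.symm hcd hxc.ne' hyd.ne hxy.ne')

/-- In a straight-line drawing of `K₅` minus the edge `c d`, one of `c` and `d` is inside the
triangle of the three other vertices. -/
theorem inside_or_inside (hD : D.IsStraightLine) {x y z c d : V} (hxy : G.Adj x y)
    (hyz : G.Adj y z) (hxz : G.Adj x z) (hxc : G.Adj x c) (hyc : G.Adj y c) (hzc : G.Adj z c)
    (hxd : G.Adj x d) (hyd : G.Adj y d) (hzd : G.Adj z d) (hcd : c ≠ d) :
    Inside (D.pos x) (D.pos y) (D.pos z) (D.pos c) ∨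
      Inside (D.pos x) (D.pos y) (D.pos z) (D.pos d) := by
  by_contra! h
  have hzx := hxz.symm
  have hyx := hxy.symm
  have hzy := hyz.symm
  have hdc := hcd.symm
  rcases (inside_or_behind hD hxy hyz hxz hxc hyc hzc).resolve_left h.1 with hc | hc | hc <;>
    rcases (inside_or_behind hD hxy hyz hxz hxd hyd hzd).resolve_left h.2 with hd | hd | hd
  · exact not_behind_behind_same hD hxy hyz hxz hxc hyc hzc hxd hyd hzd hcd hc hd
  · exact not_behind_behind_next hD hxy hyz hxz hxc hyc hxd hyd hcd hc hd
  · exact not_behind_behind_next hD hzx hxy hzy hzd hxd hzc hxc hdc hd hc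
  · exact not_behind_behind_next hD hxy hyz hxz hxd hyd hxc hyc hdc hd hc
  · exact not_behind_behind_same hD hyz hzx hyx hyc hzc hxc hyd hzd hxd hcd hc hd
  · exact not_behind_behind_next hD hyz hzx hyx hyc hzc hyd hzd hcd hc hd
  · exact not_behind_behind_next hD hzx hxy hzy hzc hxc hzd hxd hcd hc hd
  · exact not_behind_behind_next hD hyz hzx hyx hyd hzd hyc hzc hdc hd hc
  · exact not_behind_behind_same hD hzx hxy hzy hzc hxc hyc hzd hxd hyd hcd hc hd

/-- If `c` is inside the triangle `x y z` and `d` is adjacent to `x`, `y`, `c`, then the path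
`x c y` separates `z` from `d`. -/
theorem not_disjoint_of_inside (hD : D.IsStraightLine) {x y z c d : V} (hxy : G.Adj x y)
    (hyz : G.Adj y z) (hxz : G.Adj x z) (hxc : G.Adj x c) (hyc : G.Adj y c) (hzc : G.Adj z c)
    (hxd : G.Adj x d) (hyd : G.Adj y d) (hcd : G.Adj c d) (hzd : z ≠ d)
    (hc : Inside (D.pos x) (D.pos y) (D.pos z) (D.pos c)) :
    ¬ Disjoint (segment ℝ (D.pos x) (D.pos c)) (segment ℝ (D.pos z) (D.pos d)) ∨
      ¬ Disjoint (segment ℝ (D.pos y) (D.pos c)) (segment ℝ (D.pos z) (D.pos d)) := by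
  have hT := orient_ne_zero hD hxy hyz hxz
  refine not_disjoint_of_inside_of_inside hT hc ?_
  exact (inside_or_inside hD hxy hyc hxc hxz hyz hzc.symm hxd hyd hcd hzd).resolve_left
    (not_inside_of_inside hT hc)

end Drawing

/-! ### Planar drawings from points in general position -/

section Planarity

variable {V : Type*} {G : SimpleGraph V}

theorem convexHull_image_mk (p : V → Plane) (u v : V) :
    convexHull ℝ (p '' {w | w ∈ s(u, v)}) = segment ℝ (p u) (p v) := by
  rw [← convexHull_pair]
  congr 1
  ext q
  simp [eq_comm]

theorem isArcBetween_segment {p q : Plane} (h : p ≠ q) : IsArcBetween (segment ℝ p q) p q :=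
  ⟨Path.segment p q, Path.segment_injective_of_ne h, Path.range_segment p q⟩

theorem orient_eq_zero_of_mem_segment {p q r : Plane} (h : r ∈ segment ℝ p q) :
    orient p q r = 0 := by
  obtain ⟨a, b, -, -, hab, rfl⟩ := h
  obtain rfl : a = 1 - b := by linarith
  simp only [orient, PiLp.add_apply, PiLp.smul_apply, smul_eq_mul]
  ring

theorem disjoint_segment_of_orient_pos {p q r s : Plane}
    (h : 0 < orient p q r * orient p q s) : Disjoint (segment ℝ p q) (segment ℝ r s) := by
  refine Set.disjoint_left.2 fun w hw hw' => ?_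
  have h0 := orient_eq_zero_of_mem_segment hw
  obtain ⟨a, b, ha, hb, hab, rfl⟩ := hw'
  have e : orient p q (a • r + b • s) = a * orient p q r + b * orient p q s := by
    obtain rfl : a = 1 - b := by linarith
    simp only [orient, PiLp.add_apply, PiLp.smul_apply, smul_eq_mul]
    ring
  rw [e] at h0
  rcases mul_pos_iff.1 h with ⟨h1, h2⟩ | ⟨h1, h2⟩ <;>
    rcases ha.eq_or_lt with rfl | ha
  all_goals nlinarith

theorem eq_of_mem_segment_of_mem_segment {p q r w : Plane} (h : orient p q r ≠ 0)
    (h₁ : w ∈ segment ℝ p q) (h₂ : w ∈ segment ℝ p r) : w = p := by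
  have h0 := orient_eq_zero_of_mem_segment h₁
  obtain ⟨a, b, ha, hb, hab, rfl⟩ := h₂
  obtain rfl : a = 1 - b := by linarith
  have e : orient p q ((1 - b) • p + b • r) = b * orient p q r := by
    simp only [orient, PiLp.add_apply, PiLp.smul_apply, smul_eq_mul]
    ring
  rw [e] at h0
  simp [(mul_eq_zero.1 h0).resolve_right h]

/-- A straight-line drawing given by points in general position. -/
def straightLineDrawing (p : V → Plane) (hp : Function.Injective p)
    (h₁ : ∀ u v w, u ≠ v → u ≠ w → v ≠ w → orient (p u) (p v) (p w) ≠ 0)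
    (h₂ : ∀ u v w t, G.Adj u v → G.Adj w t → u ≠ w → u ≠ t → v ≠ w → v ≠ t →
      Disjoint (segment ℝ (p u) (p v)) (segment ℝ (p w) (p t))) : PlanarDrawing G where
  pos := p
  -- A convex hull needs no choice of an order of the end points.
  arc e := convexHull ℝ (p '' {w | w ∈ e})
  pos_injective := hp
  arc_isArc u v h := by
    rw [convexHull_image_mk]
    exact isArcBetween_segment (hp.ne h.ne)
  pos_notMem_arc e := by
    induction e with | h u v => ?_
    intro h w hw hm
    rw [convexHull_image_mk] at hm
    rw [Sym2.mem_iff, not_or] at hw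
    exact h₁ u v w (SimpleGraph.Adj.ne h) (Ne.symm hw.1) (Ne.symm hw.2)
      (orient_eq_zero_of_mem_segment hm)
  arc_inter_arc e he f hf := by
    induction e with | h u v => ?_
    induction f with | h w t => ?_
    intro hne x hx
    simp only [convexHull_image_mk] at hx
    rw [SimpleGraph.mem_edgeSet] at he hf
    have key : ∀ {a b c : V}, G.Adj a b → G.Adj a c → b ≠ c → x ∈ segment ℝ (p a) (p b) →
        x ∈ segment ℝ (p a) (p c) → x = p a := fun hab hac hbc hx₁ hx₂ =>
      eq_of_mem_segment_of_mem_segment (h₁ _ _ _ hab.ne hac.ne hbc) hx₁ hx₂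
    obtain ⟨hx₁, hx₂⟩ := hx
    by_cases huw : u = w
    · subst huw
      exact ⟨u, by simp, by simp, key he hf (by rintro rfl; exact hne rfl) hx₁ hx₂⟩
    by_cases hut : u = t
    · subst hut
      exact ⟨u, by simp, by simp, key he hf.symm (by rintro rfl; exact hne Sym2.eq_swap) hx₁
        (segment_symm ℝ (p u) (p w) ▸ hx₂)⟩
    by_cases hvw : v = w
    · subst hvw
      exact ⟨v, by simp, by simp, key he.symm hf (by rintro rfl; exact hne Sym2.eq_swap)
        (segment_symm ℝ (p v) (p u) ▸ hx₁) hx₂⟩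
    by_cases hvt : v = t
    · subst hvt
      exact ⟨v, by simp, by simp, key he.symm hf.symm (by rintro rfl; exact hne rfl)
        (segment_symm ℝ (p v) (p u) ▸ hx₁) (segment_symm ℝ (p v) (p w) ▸ hx₂)⟩
    exact absurd hx₂ (Set.disjoint_left.1 (h₂ u v w t he hf huw hut hvw hvt) hx₁)

end Planarity

/-! ### The seven-vertex example -/

section Construction

/-- The edges of `bipyramidGraph`, each in one direction. -/
def bipyramidEdge : Fin 7 → Fin 7 → Bool
  | 3, 5 | 1, 3 | 1, 5 | 4, 5 | 3, 4 | 1, 4 | 0, 5 | 0, 3 | 0, 4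
  | 2, 5 | 2, 3 | 1, 2 | 6, 3 | 6, 1 | 6, 2 => true
  | _, _ => false

/-- The triangle `1 3 5` with apices `4` and `2` on its two sides, and with a further vertex `0` in
the face `3 4 5` and a further vertex `6` in the face `1 2 3`. -/
def bipyramidGraph : SimpleGraph (Fin 7) :=
  SimpleGraph.fromRel fun u v => bipyramidEdge u v = true

instance : DecidableRel bipyramidGraph.Adj := fun u v =>
  inferInstanceAs (Decidable (u ≠ v ∧ (bipyramidEdge u v = true ∨ bipyramidEdge v u = true)))

/-- Coordinates of the vertices in a straight-line drawing of `bipyramidGraph`. -/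
def coord : Fin 7 → ℤ × ℤ :=
  ![(5, 6), (8, 9), (7, 6), (9, 3), (0, 9), (5, 7), (8, 7)]

/-- The integer version of `orient`. -/
def orientInt (p q r : ℤ × ℤ) : ℤ :=
  (q.1 - p.1) * (r.2 - p.2) - (q.2 - p.2) * (r.1 - p.1)

/-- The point with the given integer coordinates. -/
def toPlane (p : ℤ × ℤ) : Plane := !₂[(p.1 : ℝ), (p.2 : ℝ)]

theorem orient_toPlane (p q r : ℤ × ℤ) :
    orient (toPlane p) (toPlane q) (toPlane r) = orientInt p q r := by
  simp [orient, orientInt, toPlane]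

theorem orientInt_coord_ne_zero : ∀ u v w : Fin 7, u ≠ v → u ≠ w → v ≠ w →
    orientInt (coord u) (coord v) (coord w) ≠ 0 := by
  decide +kernel

theorem orientInt_coord_separated : ∀ u v, bipyramidGraph.Adj u v → ∀ w t,
    bipyramidGraph.Adj w t → u ≠ w → u ≠ t → v ≠ w → v ≠ t →
    0 < orientInt (coord u) (coord v) (coord w) * orientInt (coord u) (coord v) (coord t) ∨
      0 < orientInt (coord w) (coord t) (coord u) * orientInt (coord w) (coord t) (coord v) := by
  decide +kernel

theorem isPlanarGraph_bipyramidGraph : IsPlanarGraph bipyramidGraph := by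
  refine ⟨straightLineDrawing (fun v => toPlane (coord v)) ?_ ?_ ?_⟩
  · intro u v h
    have h0 : ((coord u).1 : ℝ) = (coord v).1 := by simpa [toPlane] using congrArg (· 0) h
    have h1 : ((coord u).2 : ℝ) = (coord v).2 := by simpa [toPlane] using congrArg (· 1) h
    have hinj : ∀ u v, coord u = coord v → u = v := by decide
    exact hinj u v (Prod.ext (Int.cast_injective h0) (Int.cast_injective h1))
  · intro u v w huv huw hvw
    rw [orient_toPlane, Int.cast_ne_zero]
    exact orientInt_coord_ne_zero u v w huv huw hvw
  · intro u v w t h h' huw hut hvw hvt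
    rcases orientInt_coord_separated u v h w t h' huw hut hvw hvt with h | h
    · refine disjoint_segment_of_orient_pos ?_
      rw [orient_toPlane, orient_toPlane]
      exact_mod_cast h
    · refine (disjoint_segment_of_orient_pos ?_).symm
      rw [orient_toPlane, orient_toPlane]
      exact_mod_cast h

/-- This replaces walks by bounded quantifiers, so that `exists_center` is decidable. -/
theorem connected_of_radius_le_two {V : Type*} {G : SimpleGraph V} (r : V)
    (h : ∀ v, v = r ∨ G.Adj r v ∨ ∃ w, G.Adj r w ∧ G.Adj w v) : G.Connected := by
  rw [SimpleGraph.connected_iff_exists_forall_reachable]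
  refine ⟨r, fun v => ?_⟩
  rcases h v with rfl | h | ⟨w, h, h'⟩
  · rfl
  · exact h.reachable
  · exact h.reachable.trans h'.reachable

theorem exists_center : ∀ S : Finset (Fin 7), S.card ≤ 2 → ∃ r, r ∉ S ∧ ∀ v, v ∉ S →
    v = r ∨ bipyramidGraph.Adj r v ∨
      ∃ w, w ∉ S ∧ bipyramidGraph.Adj r w ∧ bipyramidGraph.Adj w v := by
  decide +kernel

theorem isTriconnected_bipyramidGraph : IsTriconnected bipyramidGraph := by
  refine ⟨by simp, fun S hS => ?_⟩
  obtain ⟨r, hr, h⟩ := exists_center S hS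
  refine connected_of_radius_le_two ⟨r, hr⟩ ?_
  rintro ⟨v, hv⟩
  rcases h v hv with h | h | ⟨w, hw, h, h'⟩
  · exact Or.inl (Subtype.ext h)
  · exact Or.inr (Or.inl h)
  · exact Or.inr (Or.inr ⟨⟨w, hw⟩, h, h'⟩)

theorem not_hasSGE_bipyramidGraph : ¬ HasSGE bipyramidGraph (SimpleGraph.pathGraph 7) := by
  rintro ⟨D, D', hD, hD', hpos⟩
  have hP : ∀ u v : Fin 7, u.val + 1 = v.val → (SimpleGraph.pathGraph 7).Adj u v := fun u v h =>
    SimpleGraph.pathGraph_adj.2 (Or.inl h)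
  rcases inside_or_inside hD (x := 5) (y := 3) (z := 1) (c := 4) (d := 2) (by decide) (by decide)
    (by decide) (by decide) (by decide) (by decide) (by decide) (by decide) (by decide)
    (by decide) with h | h
  · rcases not_disjoint_of_inside hD (d := 0) (by decide) (by decide) (by decide) (by decide)
      (by decide) (by decide) (by decide) (by decide) (by decide) (by decide) h with h | h <;>
    · simp only [hpos] at h
      refine h (disjoint_segment hD' ?_ (hP 0 1 rfl).symm ?_ ?_ ?_ ?_)
      · first | exact hP 3 4 rfl | exact (hP 4 5 rfl).symm
      all_goals decide
  · have h' : Inside (D.pos 1) (D.pos 3) (D.pos 5) (D.pos 2) := by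
      obtain ⟨α, β, γ, hα, hβ, hγ, hs, hc⟩ := h
      exact ⟨γ, β, α, hγ, hβ, hα, by linarith, by rw [hc]; abel⟩
    rcases not_disjoint_of_inside hD (d := 6) (by decide) (by decide) (by decide) (by decide)
      (by decide) (by decide) (by decide) (by decide) (by decide) (by decide) h' with h | h <;>
    · simp only [hpos] at h
      refine h (disjoint_segment hD' ?_ (hP 5 6 rfl) ?_ ?_ ?_ ?_)
      · first | exact hP 1 2 rfl | exact (hP 2 3 rfl).symm
      all_goals decide

end Construction

end PathGraphSGE

theorem theorem2 :
    ∃ (n : ℕ) (G P : SimpleGraph (Fin n)),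
      IsPlanarGraph G ∧ IsTriconnected G ∧ IsSpanningPath P ∧ ¬ HasSGE G P :=
  ⟨7, PathGraphSGE.bipyramidGraph, SimpleGraph.pathGraph 7,
    PathGraphSGE.isPlanarGraph_bipyramidGraph, PathGraphSGE.isTriconnected_bipyramidGraph,
    ⟨SimpleGraph.Iso.refl⟩, PathGraphSGE.not_hasSGE_bipyramidGraph⟩
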